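/- Let $Q\ge 2$ and $P$ be coprime integers, $\alpha=P/Q$, $q=e^{i\pi\alpha}$, $\omega=q^2=e^{2\pi i\alpha}$. Let $V$ be the $Q\times Q$ cyclic shift matrix ($V_{k,k+1}=1$ for $1\le k\le Q-1$, $V_{Q,1}=1$, all other entries $0$), let $U=\mathrm{diag}(1,\omega,\dots,\omega^{Q-1})$, and let $$\hat H(\nu_x,\nu_y)=e^{i\nu_x}V+e^{-i\nu_x}V^*+e^{i\nu_y}U+e^{-i\nu_y}U^*$$ be the finite-dimensional Hofstadter Hamiltonian. Let $\mathcal U_q(\mathfrak{sl}_2)$ be the unital associative $\mathbb C$-algebra generated by $E,F,K^{\pm1}$ with relations $KK^{-1}=K^{-1}K=1$, $KE=q^2EK$, $KF=q^{-2}FK$, $EF-FE=(K-K^{-1})/(q-q^{-1})$. For $\lambda\in\mathbb C\setminus\{0\}$ let $Z_\lambda$ be its $Q$-dimensional representation in which $F$ acts by the matrix with $1$'s on the subdiagonal, $E$ by the matrix with entries $-b_1,\dots,-b_{Q-1}$ on the superdiagonal (all other entries of both being $0$), where $b_r=(q-q^{-1})^{-2}(q^r-q^{-r})(q^{r-1}\lambda^{-1}-q^{1-r}\lambda)$,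 and $K$ by $\mathrm{diag}(\lambda,\lambda q^{-2},\dots,\lambda q^{-2(Q-1)})$. Put $\zeta=Z_{q^{-1}}$ and $\hat H'=i(q-q^{-1})\,\zeta(F-E)$. Then: 1. $\hat H'=-2\sin(\pi\alpha)\,J$, where $J$ is the $Q\times Q$ tridiagonal matrix with zero diagonal, $1$'s on the subdiagonal and $\sin^2(k\pi\alpha)/\sin^2(\pi\alpha)$, $k=1,\dots,Q-1$, on the superdiagonal. The matrix $\hat H'$ is not Hermitian when $Q\ge 4$. 2. At the mid-band point $\nu_x=\frac{\pi}{2Q}$, $\nu_y=\pm\frac{\pi}{2Q}$ (for either sign), the matrix $\hat H=\hat H(\nu_x,\nu_y)$ is Hermitian and has the same characteristic polynomial as $\hat H'$: $\det(\hat H-E)=\det(\hat H'-E)$ for all $E\in\mathbb C$. -/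

import Mathlib

noncomputable section

namespace Hofstadter

open Complex
open scoped Matrix

/-- The magnetic flux `α = P / Q`. -/
def flux (P : ℤ) (Q : ℕ) : ℝ := (P : ℝ) / (Q : ℝ)

/-- The deformation parameter `q = exp (i π α)`. -/
def qParam (P : ℤ) (Q : ℕ) : ℂ := exp (I * (Real.pi : ℂ) * (flux P Q : ℂ))

/-! ### The finite-dimensional Hofstadter Hamiltonian -/

/-- The cyclic shift matrix: ones on the superdiagonal and in the lower left corner. -/
def shiftV (Q : ℕ) : Matrix (Fin Q) (Fin Q) ℂ :=
  Matrix.of fun i j => if (j : ℕ) = ((i : ℕ) + 1) % Q then 1 else 0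

/-- The clock matrix `diag (1, ω, …, ω ^ (Q - 1))` with `ω = q ^ 2 = exp (2 π i α)`. -/
def clockU (P : ℤ) (Q : ℕ) : Matrix (Fin Q) (Fin Q) ℂ :=
  Matrix.diagonal fun k => (qParam P Q ^ 2) ^ (k : ℕ)

/-- The finite-dimensional Hofstadter Hamiltonian
`e^{iν_x} V + e^{-iν_x} V* + e^{iν_y} U + e^{-iν_y} U*`. -/
def hofstadterH (P : ℤ) (Q : ℕ) (nux nuy : ℝ) : Matrix (Fin Q) (Fin Q) ℂ :=
  exp (I * (nux : ℂ)) • shiftV Q + exp (-(I * (nux : ℂ))) • (shiftV Q)ᴴ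
    + exp (I * (nuy : ℂ)) • clockU P Q + exp (-(I * (nuy : ℂ))) • (clockU P Q)ᴴ

/-! ### The quantum group `U_q(sl₂)` -/

/-- The generators `E`, `F`, `K`, `K⁻¹`. -/
inductive UqGen : Type
  | E : UqGen
  | F : UqGen
  | K : UqGen
  | Kinv : UqGen

/-- The defining relations of `U_q(sl₂)`. -/
inductive UqRel (q : ℂ) : FreeAlgebra ℂ UqGen → FreeAlgebra ℂ UqGen → Prop
  | K_mul_Kinv :
      UqRel q (FreeAlgebra.ι ℂ UqGen.K * FreeAlgebra.ι ℂ UqGen.Kinv) 1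
  | Kinv_mul_K :
      UqRel q (FreeAlgebra.ι ℂ UqGen.Kinv * FreeAlgebra.ι ℂ UqGen.K) 1
  | K_mul_E :
      UqRel q (FreeAlgebra.ι ℂ UqGen.K * FreeAlgebra.ι ℂ UqGen.E)
        (q ^ 2 • (FreeAlgebra.ι ℂ UqGen.E * FreeAlgebra.ι ℂ UqGen.K))
  | K_mul_F :
      UqRel q (FreeAlgebra.ι ℂ UqGen.K * FreeAlgebra.ι ℂ UqGen.F)
        ((q ^ 2)⁻¹ • (FreeAlgebra.ι ℂ UqGen.F * FreeAlgebra.ι ℂ UqGen.K))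
  | E_F :
      UqRel q
        (FreeAlgebra.ι ℂ UqGen.E * FreeAlgebra.ι ℂ UqGen.F
          - FreeAlgebra.ι ℂ UqGen.F * FreeAlgebra.ι ℂ UqGen.E)
        ((q - q⁻¹)⁻¹ • (FreeAlgebra.ι ℂ UqGen.K - FreeAlgebra.ι ℂ UqGen.Kinv))

/-- The associative unital algebra `U_q(sl₂)` over `ℂ`. -/
abbrev Uq (q : ℂ) : Type := RingQuot (UqRel q)

/-- The image in `U_q(sl₂)` of a generator. -/
def Uq.gen (q : ℂ) (g : UqGen) : Uq q :=
  RingQuot.mkAlgHom ℂ (UqRel q) (FreeAlgebra.ι ℂ g)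

/-! ### The representations `Z_lam` -/

/-- `b_r = (q - q⁻¹)⁻² (q^r - q^{-r}) (q^{r-1} lam⁻¹ - q^{1-r} lam)`. -/
def bCoeff (q lam : ℂ) (r : ℤ) : ℂ :=
  ((q - q⁻¹) ^ 2)⁻¹ * (q ^ r - q ^ (-r)) * (q ^ (r - 1) * lam⁻¹ - q ^ (1 - r) * lam)

/-- `Z_lam (E)`: the entries `-b_1, …, -b_{n-1}` on the superdiagonal. -/
def zE (n : ℕ) (q lam : ℂ) : Matrix (Fin n) (Fin n) ℂ :=
  Matrix.of fun i j => if (j : ℕ) = (i : ℕ) + 1 then -bCoeff q lam ((i : ℤ) + 1) else 0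

/-- `Z_lam (F)`: ones on the subdiagonal. -/
def zF (n : ℕ) : Matrix (Fin n) (Fin n) ℂ :=
  Matrix.of fun i j => if (i : ℕ) = (j : ℕ) + 1 then 1 else 0

/-- `Z_lam (K) = diag (lam, lam q⁻², …, lam q^{-2(n-1)})`. -/
def zK (n : ℕ) (q lam : ℂ) : Matrix (Fin n) (Fin n) ℂ :=
  Matrix.diagonal fun i => lam * (q ^ 2)⁻¹ ^ (i : ℕ)

/-- `Z_lam (K⁻¹)`. -/
def zKinv (n : ℕ) (q lam : ℂ) : Matrix (Fin n) (Fin n) ℂ :=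
  Matrix.diagonal fun i => lam⁻¹ * (q ^ 2) ^ (i : ℕ)

/-- The matrices by which the generators act in `Z_lam`. -/
def zGen (n : ℕ) (q lam : ℂ) : UqGen → Matrix (Fin n) (Fin n) ℂ
  | UqGen.E => zE n q lam
  | UqGen.F => zF n
  | UqGen.K => zK n q lam
  | UqGen.Kinv => zKinv n q lam

lemma bCoeff_sub (q lam : ℂ) (hq : q ≠ 0) (hq1 : q - q⁻¹ ≠ 0) (hl : lam ≠ 0) (k : ℕ) :
    -bCoeff q lam ((k : ℤ) + 1) + bCoeff q lam (k : ℤ) =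
      (q - q⁻¹)⁻¹ * (lam * (q ^ 2)⁻¹ ^ k - lam⁻¹ * (q ^ 2) ^ k) := by
  have h2 : q ^ 2 - 1 ≠ 0 := by
    intro h; apply hq1; field_simp; rw [h, mul_zero]
  simp only [bCoeff]
  have e1 : q ^ ((k : ℤ) + 1) = q ^ k * q := by
    rw [zpow_add₀ hq]; simp
  have e2 : q ^ (-((k : ℤ) + 1)) = (q ^ k)⁻¹ * q⁻¹ := by
    rw [zpow_neg, e1, mul_inv]
  have e3 : q ^ ((k : ℤ) + 1 - 1) = q ^ k := by simp
  have e4 : q ^ (1 - ((k : ℤ) + 1)) = (q ^ k)⁻¹ := by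
    rw [show 1 - ((k : ℤ) + 1) = -(k : ℤ) by ring, zpow_neg]; simp
  have e5 : q ^ (-(k : ℤ)) = (q ^ k)⁻¹ := by rw [zpow_neg]; simp
  have e6 : q ^ ((k : ℤ) - 1) = q ^ k * q⁻¹ := by rw [zpow_sub₀ hq]; simp [div_eq_mul_inv]
  have e7 : q ^ (1 - (k : ℤ)) = (q ^ k)⁻¹ * q := by
    rw [zpow_sub₀ hq]; simp [div_eq_mul_inv, mul_comm]
  have e8 : (q ^ 2)⁻¹ ^ k = ((q ^ k)⁻¹) ^ 2 := by
    rw [inv_pow, inv_pow, ← pow_mul, ← pow_mul, mul_comm]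
  have e9 : (q ^ 2) ^ k = (q ^ k) ^ 2 := by rw [← pow_mul, ← pow_mul, mul_comm]
  rw [e1, e2, e3, e4, e5, e6, e7, e8, e9, zpow_natCast]
  have hk : q ^ k ≠ 0 := pow_ne_zero _ hq
  generalize q ^ k = x at hk
  field_simp
  ring

lemma zE_mul_zF (n : ℕ) (q lam : ℂ) (hn : q ^ n - (q ^ n)⁻¹ = 0) :
    zE n q lam * zF n = Matrix.diagonal fun i : Fin n => -bCoeff q lam ((i : ℤ) + 1) := by
  ext i j
  rw [Matrix.mul_apply]
  by_cases hi : (i : ℕ) + 1 < n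
  · rw [Finset.sum_eq_single (⟨(i : ℕ) + 1, hi⟩ : Fin n)]
    · by_cases hij : i = j
      · subst hij; simp [zE, zF]
      · have : (i : ℕ) ≠ j := fun h => hij (Fin.ext h)
        simp [zE, zF, hij, this]
    · intro k _ hk
      have : (k : ℕ) ≠ (i : ℕ) + 1 := fun h => hk (Fin.ext h)
      simp [zE, this]
    · simp
  · have hin : (i : ℕ) + 1 = n := by omega
    have hb : bCoeff q lam ((i : ℤ) + 1) = 0 := by
      have : ((i : ℤ) + 1) = (n : ℤ) := by exact_mod_cast hin
      rw [this, bCoeff, zpow_neg, zpow_natCast, hn]; simp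
    rw [Finset.sum_eq_zero]
    · by_cases hij : i = j
      · subst hij; simp [hb]
      · simp [hij]
    · intro k _
      have : (k : ℕ) ≠ (i : ℕ) + 1 := by omega
      simp [zE, this]

lemma zF_mul_zE (n : ℕ) (q lam : ℂ) :
    zF n * zE n q lam = Matrix.diagonal fun i : Fin n => -bCoeff q lam (i : ℤ) := by
  ext i j
  rw [Matrix.mul_apply]
  rcases Nat.eq_zero_or_pos (i : ℕ) with hi | hi
  · rw [Finset.sum_eq_zero]
    · by_cases hij : i = j
      · subst hij; simp [hi, bCoeff]
      · simp [hij]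
    · intro k _
      have : (i : ℕ) ≠ (k : ℕ) + 1 := by omega
      simp [zF, this]
  · rw [Finset.sum_eq_single (⟨(i : ℕ) - 1, by omega⟩ : Fin n)]
    · have h1 : (i : ℕ) = (i : ℕ) - 1 + 1 := by omega
      have h2 : (((i : ℕ) - 1 : ℕ) : ℤ) + 1 = (i : ℤ) := by omega
      by_cases hij : i = j
      · subst hij
        simp only [zE, zF, Matrix.of_apply, Matrix.diagonal_apply_eq]
        rw [if_pos h1, if_pos h1, h2, one_mul]
      · have h3 : ¬ ((j : ℕ) = (i : ℕ) - 1 + 1) := fun h => hij (Fin.ext (by omega))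
        simp only [zE, Matrix.of_apply]
        rw [if_neg h3, mul_zero, Matrix.diagonal_apply_ne _ hij]
    · intro k _ hk
      have : (i : ℕ) ≠ (k : ℕ) + 1 := fun h => hk (Fin.ext (by simp; omega))
      simp [zF, this]
    · simp

lemma zGen_rel (n : ℕ) (hn : 2 ≤ n) (q lam : ℂ) (hq : IsPrimitiveRoot (q ^ 2) n)
    (hl : lam ≠ 0) {x y : FreeAlgebra ℂ UqGen} (h : UqRel q x y) :
    FreeAlgebra.lift ℂ (zGen n q lam) x = FreeAlgebra.lift ℂ (zGen n q lam) y := by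
  have hq2 : q ^ 2 ≠ 0 := hq.ne_zero (by omega)
  have hq0 : q ≠ 0 := by rintro rfl; simp at hq2
  have hq1 : q - q⁻¹ ≠ 0 := by
    intro h
    apply hq.ne_one (by omega)
    field_simp at h
    linear_combination h
  have hqn : q ^ n - (q ^ n)⁻¹ = 0 := by
    have h1 := hq.pow_eq_one
    have hne : q ^ n ≠ 0 := pow_ne_zero _ hq0
    field_simp
    rw [← pow_mul, mul_comm n 2, pow_mul, h1, sub_self, mul_zero]
  have hpow : ∀ k : ℕ, (q ^ 2) ^ k ≠ 0 := fun k => pow_ne_zero _ hq2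
  cases h with
  | K_mul_Kinv =>
    simp only [map_mul, FreeAlgebra.lift_ι_apply, zGen, zK, zKinv, map_one,
      Matrix.diagonal_mul_diagonal]
    rw [← Matrix.diagonal_one]
    congr 1; ext k
    have := hpow k
    rw [inv_pow]; field_simp
  | Kinv_mul_K =>
    simp only [map_mul, FreeAlgebra.lift_ι_apply, zGen, zK, zKinv, map_one,
      Matrix.diagonal_mul_diagonal]
    rw [← Matrix.diagonal_one]
    congr 1; ext k
    have := hpow k
    rw [inv_pow]; field_simp
  | K_mul_E =>
    simp only [map_mul, map_smul, FreeAlgebra.lift_ι_apply, zGen]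
    ext i j
    simp only [zK, Matrix.diagonal_mul, Matrix.mul_diagonal, Matrix.smul_apply, smul_eq_mul, zE,
      Matrix.of_apply]
    split_ifs with hij
    · simp only [hij, inv_pow, pow_succ]; have := hpow (i : ℕ); field_simp
    · simp
  | K_mul_F =>
    simp only [map_mul, map_smul, FreeAlgebra.lift_ι_apply, zGen]
    ext i j
    simp only [zK, Matrix.diagonal_mul, Matrix.mul_diagonal, Matrix.smul_apply, smul_eq_mul, zF,
      Matrix.of_apply]
    split_ifs with hij
    · rw [hij, pow_succ]; ring
    · simp
  | E_F =>
    simp only [map_mul, map_sub, map_smul, FreeAlgebra.lift_ι_apply, zGen]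
    rw [zE_mul_zF n q lam hqn, zF_mul_zE]
    ext i j
    by_cases hij : i = j
    · subst hij
      simp only [zK, zKinv, Matrix.sub_apply, Matrix.diagonal_apply_eq, Matrix.smul_apply,
        smul_eq_mul]
      rw [← bCoeff_sub q lam hq0 hq1 hl]; ring
    · simp [zK, zKinv, hij]

/-- The `n`-dimensional representation `Z_lam = Z_{0,0}(lam)` of `U_q(sl₂)`, for `q ^ 2` a
primitive `n`-th root of unity. -/
def zRep (n : ℕ) (hn : 2 ≤ n) (q lam : ℂ) (hq : IsPrimitiveRoot (q ^ 2) n) (hl : lam ≠ 0) :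
    Uq q →ₐ[ℂ] Matrix (Fin n) (Fin n) ℂ :=
  RingQuot.liftAlgHom ℂ ⟨FreeAlgebra.lift ℂ (zGen n q lam), fun _ _ h => zGen_rel n hn q lam hq hl h⟩

lemma qParam_ne_zero (P : ℤ) (Q : ℕ) : qParam P Q ≠ 0 := exp_ne_zero _

lemma qParam_sq_isPrimitiveRoot (P : ℤ) (Q : ℕ) (hQ : 2 ≤ Q) (hPQ : IsCoprime P (Q : ℤ)) :
    IsPrimitiveRoot (qParam P Q ^ 2) Q := by
  have h := Complex.isPrimitiveRoot_exp Q (by omega)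
  have h' := h.zpow_of_gcd_eq_one P (Int.isCoprime_iff_gcd_eq_one.mp hPQ)
  have e : qParam P Q ^ 2 = exp (2 * (Real.pi : ℂ) * I / (Q : ℂ)) ^ P := by
    rw [qParam, ← exp_nat_mul, ← exp_int_mul]
    congr 1
    simp only [flux]
    push_cast
    ring
  rw [e]; exact h'

/-- The representation `ζ = Z_{q⁻¹}`. -/
def zeta (P : ℤ) (Q : ℕ) (hQ : 2 ≤ Q) (hPQ : IsCoprime P (Q : ℤ)) :
    Uq (qParam P Q) →ₐ[ℂ] Matrix (Fin Q) (Fin Q) ℂ :=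
  zRep Q hQ (qParam P Q) (qParam P Q)⁻¹ (qParam_sq_isPrimitiveRoot P Q hQ hPQ)
    (inv_ne_zero (qParam_ne_zero P Q))

/-- `Ĥ' = i (q - q⁻¹) ζ(F - E)`. -/
def hofstadterH' (P : ℤ) (Q : ℕ) (hQ : 2 ≤ Q) (hPQ : IsCoprime P (Q : ℤ)) :
    Matrix (Fin Q) (Fin Q) ℂ :=
  (I * (qParam P Q - (qParam P Q)⁻¹)) •
    zeta P Q hQ hPQ (Uq.gen (qParam P Q) UqGen.F - Uq.gen (qParam P Q) UqGen.E)

/-- The tridiagonal matrix `J`: zero diagonal, ones on the subdiagonal, and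
`sin² (k π α) / sin² (π α)`, for `k = 1, …, Q - 1`, on the superdiagonal. -/
def matJ (P : ℤ) (Q : ℕ) : Matrix (Fin Q) (Fin Q) ℂ :=
  Matrix.of fun i j =>
    if (i : ℕ) = (j : ℕ) + 1 then 1
    else if (j : ℕ) = (i : ℕ) + 1 then
      ((Real.sin (((i : ℝ) + 1) * Real.pi * flux P Q) ^ 2
        / Real.sin (Real.pi * flux P Q) ^ 2 : ℝ) : ℂ)
    else 0

end Hofstadter

end

noncomputable section

namespace Hofstadter

open Complex
open scoped Matrix

/-! ### Shift and clock matrices -/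

/-! Write the Hofstadter Hamiltonian as `c V + c⁻¹ V* + B + B⁻¹` with `B = y U`, where `V B = w B V`
and `w = q ^ 2` is a primitive `Q`-th root of unity. Since `V ^ Q = 1`, the pair `(V, B)` is
determined up to simultaneous conjugation by the scalar `B ^ Q`. So `B` may be replaced, without
changing the spectrum, by any `B'` with the same commutation relation and the same `Q`-th power
(`charpoly_weyl_pair`). The choice `B' = -(c w) U V` gives a tridiagonal matrix: the coefficient of
the cyclic corner becomes a multiple of `1 - w ^ Q = 0` (`shiftV_add_gauge_eq_tridiag`). At the
mid-band point both `Q`-th powers are `± I`; if they differ in sign, exchanging `U` with `U*`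
repairs this (`charpoly_hofstadterH_midband`). The products of opposite entries are then `(1 - w ^
k) (1 - w⁻¹ ^ k) = 4 sin² (k π α)`, the same as for `hofstadterH'`. These products fix the
characteristic polynomial (`charpoly_tridiag_congr`). -/

/-- The clock matrix `diag (1, w, …, w ^ (Q - 1))`. -/
def clock (Q : ℕ) (w : ℂ) : Matrix (Fin Q) (Fin Q) ℂ :=
  Matrix.diagonal fun k => w ^ (k : ℕ)

lemma shiftV_apply (Q : ℕ) (i j : Fin Q) :
    shiftV Q i j = if (j : ℕ) = ((i : ℕ) + 1) % Q then 1 else 0 := rfl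

lemma shiftV_conjTranspose_apply (Q : ℕ) (i j : Fin Q) :
    (shiftV Q)ᴴ i j = if (i : ℕ) = ((j : ℕ) + 1) % Q then 1 else 0 := by
  rw [Matrix.conjTranspose_apply, shiftV_apply]
  split_ifs <;> simp

lemma shiftV_mul_apply (Q : ℕ) (M : Matrix (Fin Q) (Fin Q) ℂ) (i j : Fin Q) :
    (shiftV Q * M) i j = M ⟨((i : ℕ) + 1) % Q, Nat.mod_lt _ (by have := i.2; omega)⟩ j := by
  rw [Matrix.mul_apply, Finset.sum_eq_single
    (⟨((i : ℕ) + 1) % Q, Nat.mod_lt _ (by have := i.2; omega)⟩ : Fin Q)]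
  · simp [shiftV_apply]
  · intro k _ hk
    rw [shiftV_apply, if_neg fun h => hk (Fin.ext h), zero_mul]
  · simp

lemma shiftV_pow_apply (Q n : ℕ) (i j : Fin Q) :
    (shiftV Q ^ n) i j = if (j : ℕ) = ((i : ℕ) + n) % Q then 1 else 0 := by
  induction n generalizing i with
  | zero =>
    simp only [pow_zero, add_zero, Nat.mod_eq_of_lt i.2, Matrix.one_apply, Fin.ext_iff, eq_comm]
  | succ n ih =>
    rw [pow_succ', shiftV_mul_apply, ih]
    simp only [Nat.mod_add_mod]
    rw [add_assoc, add_comm 1 n]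

lemma shiftV_pow_card (Q : ℕ) : shiftV Q ^ Q = 1 := by
  ext i j
  rw [shiftV_pow_apply, Nat.add_mod_right, Nat.mod_eq_of_lt i.2, Matrix.one_apply]
  simp only [Fin.ext_iff, eq_comm]

lemma shiftV_mul_conjTranspose (Q : ℕ) : shiftV Q * (shiftV Q)ᴴ = 1 := by
  ext i j
  rw [shiftV_mul_apply, shiftV_conjTranspose_apply, Matrix.one_apply]
  have hi := i.2
  have hj := j.2
  refine if_congr ⟨fun h => ?_, fun h => by rw [h]⟩ rfl rfl
  have h' : (i : ℕ) + 1 ≡ (j : ℕ) + 1 [MOD Q] := h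
  exact Fin.ext (Nat.ModEq.eq_of_lt_of_lt (Nat.ModEq.add_right_cancel' 1 h') hi hj)

lemma shiftV_mulVec_one (Q : ℕ) : shiftV Q *ᵥ 1 = 1 := by
  ext i
  simp only [Matrix.mulVec, dotProduct, Pi.one_apply, mul_one]
  rw [Finset.sum_eq_single
    (⟨((i : ℕ) + 1) % Q, Nat.mod_lt _ (by have := i.2; omega)⟩ : Fin Q)]
  · simp [shiftV_apply]
  · intro k _ hk
    rw [shiftV_apply, if_neg fun h => hk (Fin.ext h)]
  · simp

lemma clock_mul_clock_inv (Q : ℕ) {w : ℂ} (hw : w ≠ 0) : clock Q w * clock Q w⁻¹ = 1 := by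
  rw [clock, clock, Matrix.diagonal_mul_diagonal, ← Matrix.diagonal_one]
  congr 1
  ext k
  rw [← mul_pow, mul_inv_cancel₀ hw, one_pow]

lemma clock_pow_card (Q : ℕ) {w : ℂ} (hw : w ^ Q = 1) : clock Q w ^ Q = 1 := by
  rw [clock, Matrix.diagonal_pow, ← Matrix.diagonal_one]
  congr 1
  ext k
  rw [Pi.pow_apply, ← pow_mul, mul_comm, pow_mul, hw, one_pow]

lemma shiftV_mul_clock (Q : ℕ) {w : ℂ} (hw : w ^ Q = 1) :
    shiftV Q * clock Q w = w • (clock Q w * shiftV Q) := by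
  ext i j
  simp only [clock, Matrix.mul_diagonal, Matrix.diagonal_mul, Matrix.smul_apply, smul_eq_mul,
    shiftV_apply]
  split_ifs with h
  · rw [h, ← pow_eq_pow_mod _ hw, pow_succ]
    ring
  · simp

/-- Powers of a product of two elements that commute up to a scalar. -/
lemma mul_pow_of_smul_comm {A : Type*} [Ring A] [Algebra ℂ A] {w : ℂ} {u v : A}
    (h : v * u = w • (u * v)) (n : ℕ) : (u * v) ^ n = w ^ n.choose 2 • (u ^ n * v ^ n) := by
  have hv : ∀ n : ℕ, v ^ n * u = w ^ n • (u * v ^ n) := by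
    intro n
    induction n with
    | zero => simp
    | succ n ih =>
      rw [pow_succ', mul_assoc, ih, mul_smul_comm, ← mul_assoc, h, smul_mul_assoc, smul_smul,
        mul_assoc, pow_succ w]
  induction n with
  | zero => simp
  | succ n ih =>
    have h2 : (n + 1).choose 2 = n.choose 2 + n := by
      rw [Nat.choose_succ_succ' n 1, Nat.choose_one_right, add_comm]
    rw [pow_succ, ih, smul_mul_assoc, mul_assoc, ← mul_assoc (v ^ n), hv, smul_mul_assoc,
      mul_smul_comm, smul_smul, ← pow_add, h2, pow_succ u, pow_succ v]
    simp only [mul_assoc]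

/-! ### Uniqueness of the cyclic representation of the quantum torus -/

/-- The Krylov matrix, with columns `B ^ k *ᵥ 1`. -/
def krylov {Q : ℕ} (B : Matrix (Fin Q) (Fin Q) ℂ) : Matrix (Fin Q) (Fin Q) ℂ :=
  Matrix.of fun i k => (B ^ (k : ℕ) *ᵥ 1) i

/-- The cyclic companion matrix, with `b` in the upper right corner. -/
def cyclicCompanion (Q : ℕ) (b : ℂ) : Matrix (Fin Q) (Fin Q) ℂ :=
  Matrix.of fun i j => (if (i : ℕ) = (j : ℕ) + 1 then 1 else 0)
    + if (j : ℕ) + 1 = Q ∧ (i : ℕ) = 0 then b else 0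

lemma krylov_col {Q : ℕ} (B : Matrix (Fin Q) (Fin Q) ℂ) (k : Fin Q) :
    (krylov B).col k = B ^ (k : ℕ) *ᵥ 1 := rfl

/-- The all-ones vector is fixed by the shift, and each application of `B` multiplies the shift
eigenvalue by `w`. -/
lemma shiftV_mulVec_pow {Q : ℕ} {w : ℂ} {B : Matrix (Fin Q) (Fin Q) ℂ}
    (h : shiftV Q * B = w • (B * shiftV Q)) (k : ℕ) :
    shiftV Q *ᵥ (B ^ k *ᵥ 1) = w ^ k • (B ^ k *ᵥ 1) := by
  induction k with
  | zero => simp [shiftV_mulVec_one]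
  | succ k ih =>
    rw [pow_succ', Matrix.mulVec_mulVec, ← mul_assoc, h, Matrix.smul_mul, mul_assoc,
      Matrix.smul_mulVec, ← Matrix.mulVec_mulVec, ← Matrix.mulVec_mulVec, ih, Matrix.mulVec_smul,
      smul_smul, Matrix.mulVec_mulVec, pow_succ' w]

lemma shiftV_mul_krylov {Q : ℕ} {w : ℂ} {B : Matrix (Fin Q) (Fin Q) ℂ}
    (h : shiftV Q * B = w • (B * shiftV Q)) : shiftV Q * krylov B = krylov B * clock Q w := by
  ext i k
  have := congrFun (shiftV_mulVec_pow h k) i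
  rw [clock, Matrix.mul_diagonal, mul_comm]
  exact this

lemma mul_krylov {Q : ℕ} {b : ℂ} {B : Matrix (Fin Q) (Fin Q) ℂ}
    (hB : B ^ Q = b • (1 : Matrix (Fin Q) (Fin Q) ℂ)) :
    B * krylov B = krylov B * cyclicCompanion Q b := by
  ext i k
  have hl : (B * krylov B) i k = (B ^ ((k : ℕ) + 1) *ᵥ 1) i := by
    rw [pow_succ', ← Matrix.mulVec_mulVec]
    rfl
  rw [hl, Matrix.mul_apply]
  by_cases hk : (k : ℕ) + 1 < Q
  · rw [Finset.sum_eq_single (⟨(k : ℕ) + 1, hk⟩ : Fin Q)]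
    · simp [cyclicCompanion, krylov]
    · intro m _ hm
      have h1 : ¬ (m : ℕ) = (k : ℕ) + 1 := fun h => hm (Fin.ext h)
      have h2 : ¬ (k : ℕ) + 1 = Q := by omega
      simp [cyclicCompanion, h1, h2]
    · simp
  · have hkQ : (k : ℕ) + 1 = Q := by have := k.2; omega
    rw [Finset.sum_eq_single (⟨0, by omega⟩ : Fin Q)]
    · have h0 : ¬ 0 = Q := by omega
      simp [cyclicCompanion, krylov, hkQ, hB, Matrix.smul_mulVec, h0]
    · intro m _ hm
      have h1 : ¬ (m : ℕ) = (k : ℕ) + 1 := by have := m.2; omega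
      have h2 : ¬ (m : ℕ) = 0 := fun h => hm (Fin.ext h)
      simp only [cyclicCompanion, Matrix.of_apply, if_neg h1, h2, and_false, if_false, add_zero,
        mul_zero]
    · simp

/-- The columns are eigenvectors of the shift for the distinct eigenvalues `w ^ k`. None vanishes,
because a further power of `B` would then kill the all-ones vector, on which `B ^ Q` acts as `b ≠
0`. -/
lemma isUnit_krylov {Q : ℕ} {w b : ℂ} {B : Matrix (Fin Q) (Fin Q) ℂ} (hw : IsPrimitiveRoot w Q)
    (h : shiftV Q * B = w • (B * shiftV Q)) (hb : b ≠ 0)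
    (hB : B ^ Q = b • (1 : Matrix (Fin Q) (Fin Q) ℂ)) : IsUnit (krylov B) := by
  rw [← Matrix.linearIndependent_cols_iff_isUnit]
  refine Module.End.eigenvectors_linearIndependent' (Matrix.toLin' (shiftV Q))
    (fun k : Fin Q => w ^ (k : ℕ)) (fun i j hij => Fin.ext (hw.pow_inj i.2 j.2 hij)) _ fun k => ?_
  rw [Module.End.hasEigenvector_iff, Module.End.mem_eigenspace_iff, Matrix.toLin'_apply, krylov_col]
  refine ⟨shiftV_mulVec_pow h k, fun h0 => hb ?_⟩
  have h1 : B ^ Q *ᵥ (1 : Fin Q → ℂ) = 0 := by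
    rw [← pow_sub_mul_pow B k.2.le, ← Matrix.mulVec_mulVec, h0, Matrix.mulVec_zero]
  rw [hB, Matrix.smul_mulVec, Matrix.one_mulVec] at h1
  simpa using congrFun h1 k

/-- Matrices conjugate by a unit have the same characteristic polynomial. -/
lemma charpoly_eq_of_mul_eq {n : Type*} [Fintype n] [DecidableEq n] {S M N : Matrix n n ℂ}
    (hS : IsUnit S) (h : M * S = S * N) : M.charpoly = N.charpoly := by
  obtain ⟨S, rfl⟩ := hS
  have hM : M = S.val * N * S⁻¹.val := by rw [← h, mul_assoc, S.mul_inv, mul_one]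
  rw [hM, Matrix.coe_units_inv]
  exact Matrix.charpoly_units_conj S N

lemma mul_eq_of_inverse {A : Type*} [Monoid A] {x x' y y' s : A} (hx : x' * x = 1)
    (hy : y * y' = 1) (h : x * s = s * y) : x' * s = s * y' := by
  calc x' * s = x' * (s * y) * y' := by rw [mul_assoc, mul_assoc, hy, mul_one]
    _ = s * y' := by rw [← h, ← mul_assoc, hx, one_mul]

/-- Two Weyl pairs `(V, B)`, `(V, B')` with `B ^ Q = B' ^ Q` scalar give isospectral Hamiltonians. -/
lemma charpoly_weyl_pair {Q : ℕ} {w b c : ℂ} {B Bi B' Bi' : Matrix (Fin Q) (Fin Q) ℂ}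
    (hw : IsPrimitiveRoot w Q) (hb : b ≠ 0)
    (h : shiftV Q * B = w • (B * shiftV Q)) (h' : shiftV Q * B' = w • (B' * shiftV Q))
    (hB : B ^ Q = b • (1 : Matrix (Fin Q) (Fin Q) ℂ))
    (hB' : B' ^ Q = b • (1 : Matrix (Fin Q) (Fin Q) ℂ)) (hi : B * Bi = 1) (hi' : B' * Bi' = 1) :
    (c • shiftV Q + c⁻¹ • (shiftV Q)ᴴ + B + Bi).charpoly
      = (c • shiftV Q + c⁻¹ • (shiftV Q)ᴴ + B' + Bi').charpoly := by
  have hu := isUnit_krylov hw h hb hB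
  have hu' := isUnit_krylov hw h' hb hB'
  -- Each Krylov basis brings its pair to the same normal form `(clock Q w, cyclicCompanion Q b)`,
  -- so the quotient of the two basis changes intertwines the pairs.
  have key : ∀ X Y Z : Matrix (Fin Q) (Fin Q) ℂ, X * krylov B = krylov B * Y →
      Z * krylov B' = krylov B' * Y →
      X * (krylov B * (krylov B')⁻¹) = krylov B * (krylov B')⁻¹ * Z := by
    intro X Y Z h1 h2
    have hd : IsUnit (krylov B').det := (Matrix.isUnit_iff_isUnit_det _).1 hu'
    have h3 : (krylov B')⁻¹ * Z = Y * (krylov B')⁻¹ := by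
      calc (krylov B')⁻¹ * Z = (krylov B')⁻¹ * (Z * krylov B') * (krylov B')⁻¹ := by
            rw [mul_assoc, mul_assoc, Matrix.mul_nonsing_inv _ hd, mul_one]
        _ = Y * (krylov B')⁻¹ := by
            rw [h2, ← mul_assoc, Matrix.nonsing_inv_mul _ hd, one_mul]
    rw [← mul_assoc, h1, mul_assoc, mul_assoc, h3]
  have hV := key _ _ _ (shiftV_mul_krylov h) (shiftV_mul_krylov h')
  have hBB := key _ _ _ (mul_krylov hB) (mul_krylov hB')
  have hVi := mul_eq_of_inverse (mul_eq_one_comm.1 (shiftV_mul_conjTranspose Q))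
    (shiftV_mul_conjTranspose Q) hV
  have hBi := mul_eq_of_inverse (mul_eq_one_comm.1 hi) hi' hBB
  refine charpoly_eq_of_mul_eq (S := krylov B * (krylov B')⁻¹)
    (hu.mul ((Matrix.isUnit_nonsing_inv_iff).2 hu')) ?_
  simp only [add_mul, mul_add, Matrix.smul_mul, Matrix.mul_smul, hV, hVi, hBB, hBi]

/-! ### Tridiagonal matrices -/

/-- The tridiagonal matrix with zero diagonal, superdiagonal `a` and subdiagonal `b`. -/
def tridiag (n : ℕ) (a b : ℕ → ℂ) : Matrix (Fin n) (Fin n) ℂ :=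
  Matrix.of fun i j => if (i : ℕ) = (j : ℕ) + 1 then b j
    else if (j : ℕ) = (i : ℕ) + 1 then a i else 0

/-- The characteristic polynomial of a tridiagonal matrix with zero diagonal depends only on the
products of opposite entries. -/
lemma charpoly_tridiag_congr {n : ℕ} {a b a' b' : ℕ → ℂ} (hb : ∀ k, k + 1 < n → b k ≠ 0)
    (hb' : ∀ k, k + 1 < n → b' k ≠ 0) (h : ∀ k, k + 1 < n → a k * b k = a' k * b' k) :
    (tridiag n a b).charpoly = (tridiag n a' b').charpoly := by
  -- Diagonal conjugation that rescales each subdiagonal entry from `b` to `b'`.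
  set d : ℕ → ℂ := fun k => ∏ m ∈ Finset.range k, b m / b' m with hd
  have hd0 : ∀ k < n, d k ≠ 0 := fun k hk => Finset.prod_ne_zero_iff.2 fun m hm => by
    have : m + 1 < n := by have := Finset.mem_range.1 hm; omega
    exact div_ne_zero (hb m this) (hb' m this)
  have hds : ∀ k, d (k + 1) = d k * (b k / b' k) := fun k => Finset.prod_range_succ _ _
  have hu : IsUnit (Matrix.diagonal fun k : Fin n => d k) := by
    rw [Matrix.isUnit_iff_isUnit_det, Matrix.det_diagonal, isUnit_iff_ne_zero]
    exact Finset.prod_ne_zero_iff.2 fun k _ => hd0 k k.2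
  refine charpoly_eq_of_mul_eq hu ?_
  ext i j
  simp only [Matrix.mul_diagonal, Matrix.diagonal_mul, tridiag, Matrix.of_apply]
  split_ifs with h1 h2
  · have hj : (j : ℕ) + 1 < n := h1 ▸ i.2
    have := hb' j hj
    rw [h1, hds]
    field_simp
  · have hi : (i : ℕ) + 1 < n := h2 ▸ j.2
    have h3 := hb' i hi
    rw [h2, hds]
    have := h i hi
    field_simp
    linear_combination d i * this
  · simp

/-- The gauge in which the Hofstadter Hamiltonian is tridiagonal. -/
lemma shiftV_add_gauge_eq_tridiag {Q : ℕ} {w : ℂ} (hw : w ^ Q = 1) (c : ℂ) :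
    c • shiftV Q + c⁻¹ • (shiftV Q)ᴴ + (-(c * w)) • (clock Q w * shiftV Q)
        + (-(c * w))⁻¹ • ((shiftV Q)ᴴ * clock Q w⁻¹)
      = tridiag Q (fun k => c * (1 - w ^ (k + 1))) (fun k => c⁻¹ * (1 - w⁻¹ ^ (k + 1))) := by
  ext i j
  have hi := i.2
  have hj := j.2
  have e : (c • shiftV Q + c⁻¹ • (shiftV Q)ᴴ + (-(c * w)) • (clock Q w * shiftV Q)
        + (-(c * w))⁻¹ • ((shiftV Q)ᴴ * clock Q w⁻¹)) i j
      = (c * (1 - w ^ ((i : ℕ) + 1))) * shiftV Q i j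
        + (c⁻¹ * (1 - w⁻¹ ^ ((j : ℕ) + 1))) * (shiftV Q)ᴴ i j := by
    simp only [clock, Matrix.add_apply, Matrix.smul_apply, smul_eq_mul, Matrix.diagonal_mul,
      Matrix.mul_diagonal, pow_succ, neg_mul, inv_neg, mul_inv]
    ring
  have hs : (c * (1 - w ^ ((i : ℕ) + 1))) * shiftV Q i j
      = if (j : ℕ) = (i : ℕ) + 1 then c * (1 - w ^ ((i : ℕ) + 1)) else 0 := by
    rw [shiftV_apply]
    rcases Nat.lt_or_ge ((i : ℕ) + 1) Q with h | h
    · rw [Nat.mod_eq_of_lt h]; simp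
    -- The corner entry: its coefficient contains `1 - w ^ Q = 0`.
    · have h1 : (i : ℕ) + 1 = Q := by omega
      rw [h1, hw]; simp
  have ht : (c⁻¹ * (1 - w⁻¹ ^ ((j : ℕ) + 1))) * (shiftV Q)ᴴ i j
      = if (i : ℕ) = (j : ℕ) + 1 then c⁻¹ * (1 - w⁻¹ ^ ((j : ℕ) + 1)) else 0 := by
    rw [shiftV_conjTranspose_apply]
    rcases Nat.lt_or_ge ((j : ℕ) + 1) Q with h | h
    · rw [Nat.mod_eq_of_lt h]; simp
    · have h1 : (j : ℕ) + 1 = Q := by omega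
      rw [h1, inv_pow, hw]; simp
  rw [e, hs, ht]
  simp only [tridiag, Matrix.of_apply]
  split_ifs with h1 h2
  · omega
  all_goals simp

/-- Hypothesis `h` says that `y U` and `-(c w) U V` have the same `Q`-th power; the binomial
exponent comes from reordering `(U V) ^ Q`. -/
lemma charpoly_shiftV_clock {Q : ℕ} {w c y : ℂ} (hQ : Q ≠ 0) (hw : IsPrimitiveRoot w Q)
    (hc : c ≠ 0) (hy : y ≠ 0) (h : y ^ Q = (-(c * w)) ^ Q * w ^ Q.choose 2) :
    (c • shiftV Q + c⁻¹ • (shiftV Q)ᴴ + y • clock Q w + y⁻¹ • clock Q w⁻¹).charpoly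
      = (tridiag Q (fun k => c * (1 - w ^ (k + 1)))
          (fun k => c⁻¹ * (1 - w⁻¹ ^ (k + 1)))).charpoly := by
  have hw0 : w ≠ 0 := hw.ne_zero hQ
  have hwQ := hw.pow_eq_one
  have hVU := shiftV_mul_clock Q hwQ
  rw [← shiftV_add_gauge_eq_tridiag hwQ]
  refine charpoly_weyl_pair hw (pow_ne_zero Q hy) ?_ ?_ ?_ ?_ ?_ ?_
  · rw [Matrix.mul_smul, Matrix.smul_mul, hVU, smul_comm]
  · rw [Matrix.mul_smul, Matrix.smul_mul, ← mul_assoc, hVU, Matrix.smul_mul, smul_comm]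
  · rw [smul_pow, clock_pow_card Q hwQ]
  · rw [smul_pow, mul_pow_of_smul_comm hVU, clock_pow_card Q hwQ, shiftV_pow_card, mul_one,
      smul_smul, h]
  · rw [Matrix.smul_mul, Matrix.mul_smul, smul_smul, mul_inv_cancel₀ hy, one_smul,
      clock_mul_clock_inv Q hw0]
  · rw [Matrix.smul_mul, Matrix.mul_smul, smul_smul,
      mul_inv_cancel₀ (neg_ne_zero.2 (mul_ne_zero hc hw0)), one_smul, mul_assoc,
      ← mul_assoc (shiftV Q), shiftV_mul_conjTranspose, one_mul, clock_mul_clock_inv Q hw0]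

/-! ### The matrix `J` and the quantum group -/

lemma zeta_gen (P : ℤ) (Q : ℕ) (hQ : 2 ≤ Q) (hPQ : IsCoprime P (Q : ℤ)) (g : UqGen) :
    zeta P Q hQ hPQ (Uq.gen (qParam P Q) g) = zGen Q (qParam P Q) (qParam P Q)⁻¹ g := by
  simp [zeta, zRep, Uq.gen]

lemma qParam_zpow_sub (P : ℤ) (Q : ℕ) (k : ℤ) :
    qParam P Q ^ k - qParam P Q ^ (-k)
      = 2 * I * (Real.sin ((k : ℝ) * Real.pi * flux P Q) : ℂ) := by
  rw [qParam, ← exp_int_mul, ← exp_int_mul, ofReal_sin, Complex.sin]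
  push_cast
  rw [show (k : ℂ) * (I * (Real.pi : ℂ) * (flux P Q : ℂ))
      = (k : ℂ) * (Real.pi : ℂ) * (flux P Q : ℂ) * I by ring,
    show -(k : ℂ) * (I * (Real.pi : ℂ) * (flux P Q : ℂ))
      = -((k : ℂ) * (Real.pi : ℂ) * (flux P Q : ℂ)) * I by ring]
  linear_combination (exp ((k : ℂ) * (Real.pi : ℂ) * (flux P Q : ℂ) * I)
    - exp (-((k : ℂ) * (Real.pi : ℂ) * (flux P Q : ℂ)) * I)) * I_mul_I

lemma qParam_sub_inv (P : ℤ) (Q : ℕ) :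
    qParam P Q - (qParam P Q)⁻¹ = 2 * I * (Real.sin (Real.pi * flux P Q) : ℂ) := by
  simpa using qParam_zpow_sub P Q 1

lemma sin_pi_flux_ne_zero {P : ℤ} {Q : ℕ} (hQ : 2 ≤ Q) (hPQ : IsCoprime P (Q : ℤ)) :
    (Real.sin (Real.pi * flux P Q) : ℂ) ≠ 0 := by
  intro h
  have h1 := qParam_sub_inv P Q
  rw [h, mul_zero, sub_eq_zero] at h1
  apply (qParam_sq_isPrimitiveRoot P Q hQ hPQ).ne_one (by omega)
  rw [sq]
  nth_rewrite 2 [h1]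
  exact mul_inv_cancel₀ (qParam_ne_zero P Q)

/-- At `lam = q⁻¹` the two factors of `bCoeff` coincide, which is where the squared sines of `matJ`
come from. -/
lemma bCoeff_inv (q : ℂ) (hq : q ≠ 0) (k : ℤ) :
    bCoeff q q⁻¹ k = (q ^ k - q ^ (-k)) ^ 2 / (q - q⁻¹) ^ 2 := by
  have h1 : q ^ (k - 1) * q⁻¹⁻¹ = q ^ k := by
    rw [inv_inv, ← zpow_add_one₀ hq, sub_add_cancel]
  have h2 : q ^ (1 - k) * q⁻¹ = q ^ (-k) := by
    rw [← zpow_sub_one₀ hq]; congr 1; ring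
  rw [bCoeff, h1, h2, div_eq_mul_inv]
  ring

lemma hofstadterH'_eq_smul_matJ (P : ℤ) (Q : ℕ) (hQ : 2 ≤ Q) (hPQ : IsCoprime P (Q : ℤ)) :
    hofstadterH' P Q hQ hPQ = ((-2 * Real.sin (Real.pi * flux P Q) : ℝ) : ℂ) • matJ P Q := by
  have hs := sin_pi_flux_ne_zero hQ hPQ
  have hpre : I * (qParam P Q - (qParam P Q)⁻¹)
      = ((-2 * Real.sin (Real.pi * flux P Q) : ℝ) : ℂ) := by
    rw [qParam_sub_inv]
    push_cast
    linear_combination 2 * sin ((Real.pi : ℂ) * flux P Q) * I_mul_I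
  rw [hofstadterH', hpre, map_sub, zeta_gen, zeta_gen]
  congr 1
  ext i j
  simp only [zGen, zE, zF, matJ, Matrix.sub_apply, Matrix.of_apply]
  split_ifs with h1 h2 h2
  · omega
  · simp
  · rw [bCoeff_inv _ (qParam_ne_zero P Q), qParam_zpow_sub, qParam_sub_inv]
    have hI := I_ne_zero
    simp only [mul_pow]
    rw [mul_div_mul_left _ _ (by simp)]
    push_cast
    ring
  · simp

lemma four_mul_sin_sq (P : ℤ) (Q k : ℕ) :
    (1 - (qParam P Q ^ 2) ^ k) * (1 - (qParam P Q ^ 2)⁻¹ ^ k)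
      = 4 * (Real.sin ((k : ℝ) * Real.pi * flux P Q) : ℂ) ^ 2 := by
  have h := qParam_zpow_sub P Q k
  rw [zpow_neg, zpow_natCast, Int.cast_natCast] at h
  have hq : qParam P Q ^ k ≠ 0 := pow_ne_zero _ (qParam_ne_zero P Q)
  have h2 : (1 - (qParam P Q ^ 2) ^ k) * (1 - (qParam P Q ^ 2)⁻¹ ^ k)
      = -(qParam P Q ^ k - (qParam P Q ^ k)⁻¹) ^ 2 := by
    rw [inv_pow, ← pow_mul, mul_comm 2 k, pow_mul]
    field_simp
    ring
  rw [h2, h]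
  linear_combination -4 * (Real.sin ((k : ℝ) * Real.pi * flux P Q) : ℂ) ^ 2 * I_sq

lemma hofstadterH'_eq_tridiag (P : ℤ) (Q : ℕ) (hQ : 2 ≤ Q) (hPQ : IsCoprime P (Q : ℤ)) :
    hofstadterH' P Q hQ hPQ
      = tridiag Q
        (fun k => -2 * (Real.sin (((k + 1 : ℕ) : ℝ) * Real.pi * flux P Q) : ℂ) ^ 2
          / (Real.sin (Real.pi * flux P Q) : ℂ))
        (fun _ => -2 * (Real.sin (Real.pi * flux P Q) : ℂ)) := by
  have hs := sin_pi_flux_ne_zero hQ hPQ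
  rw [hofstadterH'_eq_smul_matJ]
  ext i j
  simp only [matJ, tridiag, Matrix.smul_apply, Matrix.of_apply, smul_eq_mul]
  split_ifs with h1 h2
  · simp
  · generalize Real.sin (Real.pi * flux P Q) = s at hs
    push_cast
    field_simp
  · simp

lemma charpoly_tridiag_eq_hofstadterH' {P : ℤ} {Q : ℕ} (hQ : 2 ≤ Q) (hPQ : IsCoprime P (Q : ℤ))
    {w c : ℂ} (hc : c ≠ 0) (hw : w = qParam P Q ^ 2 ∨ w = (qParam P Q ^ 2)⁻¹) :
    (tridiag Q (fun k => c * (1 - w ^ (k + 1))) (fun k => c⁻¹ * (1 - w⁻¹ ^ (k + 1)))).charpoly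
      = (hofstadterH' P Q hQ hPQ).charpoly := by
  have hs := sin_pi_flux_ne_zero hQ hPQ
  have hprim := qParam_sq_isPrimitiveRoot P Q hQ hPQ
  have hwi : IsPrimitiveRoot w⁻¹ Q := by
    rcases hw with rfl | rfl
    · exact hprim.inv
    · simpa using hprim
  rw [hofstadterH'_eq_tridiag]
  refine charpoly_tridiag_congr (fun k hk => mul_ne_zero (inv_ne_zero hc) (sub_ne_zero.2
    (hwi.pow_ne_one_of_pos_of_lt (by omega) hk).symm))
    (fun k _ => mul_ne_zero (by norm_num) hs) fun k _ => ?_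
  have h := four_mul_sin_sq P Q (k + 1)
  have h' : (1 - w ^ (k + 1)) * (1 - w⁻¹ ^ (k + 1))
      = 4 * (Real.sin (((k + 1 : ℕ) : ℝ) * Real.pi * flux P Q) : ℂ) ^ 2 := by
    rcases hw with rfl | rfl
    · exact h
    · rw [inv_inv, mul_comm, h]
  generalize Real.sin (Real.pi * flux P Q) = s at hs
  field_simp
  linear_combination h'

/-! ### The mid-band point -/

lemma conj_qParam_sq (P : ℤ) (Q : ℕ) : star (qParam P Q ^ 2) = (qParam P Q ^ 2)⁻¹ := by
  rw [← inv_pow, star_pow, qParam, ← exp_neg, star_def, ← exp_conj]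
  simp

lemma hofstadterH_eq (P : ℤ) (Q : ℕ) (nux nuy : ℝ) :
    hofstadterH P Q nux nuy = exp (I * nux) • shiftV Q + (exp (I * nux))⁻¹ • (shiftV Q)ᴴ
      + exp (I * nuy) • clock Q (qParam P Q ^ 2)
      + (exp (I * nuy))⁻¹ • clock Q (qParam P Q ^ 2)⁻¹ := by
  have h : (clockU P Q)ᴴ = clock Q (qParam P Q ^ 2)⁻¹ := by
    rw [clockU, clock, Matrix.diagonal_conjTranspose]
    congr 1
    ext k
    rw [Pi.star_apply, star_pow, conj_qParam_sq]
  rw [hofstadterH, h, exp_neg, exp_neg]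
  rfl

lemma hofstadterH_isHermitian (P : ℤ) (Q : ℕ) (nux nuy : ℝ) :
    (hofstadterH P Q nux nuy).IsHermitian := by
  have h : ∀ x : ℝ, star (exp (I * x)) = exp (-(I * x)) := fun x => by
    rw [star_def, ← exp_conj]; simp
  have h' : ∀ x : ℝ, star (exp (-(I * x))) = exp (I * x) := fun x => by
    rw [← h, star_star]
  rw [Matrix.IsHermitian, hofstadterH]
  simp only [Matrix.conjTranspose_add, Matrix.conjTranspose_smul, Matrix.conjTranspose_conjTranspose,
    h, h']
  abel

lemma pow_choose_two_sq {Q : ℕ} {w : ℂ} (hw : w ^ Q = 1) : (w ^ Q.choose 2) ^ 2 = 1 := by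
  rw [← pow_mul, Nat.choose_two_right, Nat.div_mul_cancel (Nat.even_mul_pred_self Q).two_dvd,
    pow_mul, hw, one_pow]

lemma exp_midband_pow {Q : ℕ} (hQ : Q ≠ 0) :
    exp (I * ((Real.pi / (2 * Q) : ℝ) : ℂ)) ^ Q = I := by
  have h0 : (Q : ℂ) ≠ 0 := by exact_mod_cast hQ
  rw [← exp_nat_mul, show (Q : ℂ) * (I * ((Real.pi / (2 * Q) : ℝ) : ℂ)) = Real.pi / 2 * I by
    push_cast; field_simp, exp_pi_div_two_mul_I]

lemma charpoly_hofstadterH_midband (P : ℤ) (Q : ℕ) (hQ : 2 ≤ Q) (hPQ : IsCoprime P (Q : ℤ))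
    (nuy : ℝ) (hn : nuy = Real.pi / (2 * Q) ∨ nuy = -(Real.pi / (2 * Q))) :
    (hofstadterH P Q (Real.pi / (2 * Q)) nuy).charpoly = (hofstadterH' P Q hQ hPQ).charpoly := by
  have hQ0 : Q ≠ 0 := by omega
  have hprim := qParam_sq_isPrimitiveRoot P Q hQ hPQ
  rw [hofstadterH_eq]
  set w := qParam P Q ^ 2 with hw
  have hcQ := exp_midband_pow hQ0
  have hc := exp_ne_zero (I * ((Real.pi / (2 * Q) : ℝ) : ℂ))
  have hy := exp_ne_zero (I * (nuy : ℂ))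
  have hyQ : exp (I * (nuy : ℂ)) ^ Q = I ∨ exp (I * (nuy : ℂ)) ^ Q = -I := by
    rcases hn with rfl | rfl
    · exact Or.inl hcQ
    · right
      rw [ofReal_neg, mul_neg, exp_neg, inv_pow, hcQ, inv_I]
  set c := exp (I * ((Real.pi / (2 * Q) : ℝ) : ℂ))
  set y := exp (I * (nuy : ℂ))
  have hwQ := hprim.pow_eq_one
  have hch := sq_eq_one_iff.1 (pow_choose_two_sq hwQ)
  have hg : ∀ v : ℂ, v ^ Q = 1 → (-(c * v)) ^ Q * v ^ Q.choose 2
      = (-1) ^ Q * I * v ^ Q.choose 2 := fun v hv => by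
    rw [neg_pow, mul_pow, hcQ, hv, mul_one]
  -- Here `w ^ Q.choose 2 = ± 1`, so both sides lie in `{I, -I}` and can differ only by a sign.
  have hsign : y ^ Q = (-1) ^ Q * I * w ^ Q.choose 2 ∨ y ^ Q = -((-1) ^ Q * I * w ^ Q.choose 2) := by
    rcases hyQ with h | h <;> rcases neg_one_pow_eq_or ℂ Q with h1 | h1 <;>
      rcases hch with h2 | h2 <;> simp [h, h1, h2]
  rcases hsign with h | h
  · rw [charpoly_shiftV_clock hQ0 hprim hc hy (h.trans (hg w hwQ).symm)]
    exact charpoly_tridiag_eq_hofstadterH' hQ hPQ hc (Or.inl rfl)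
  -- Wrong sign: view the Hamiltonian with `w⁻¹`, `y⁻¹` in place of `w`, `y`. Inverting `± I` flips
  -- its sign, while the required value is unchanged because `w ^ Q.choose 2 = ± 1` is its own
  -- inverse.
  · have hwi : (w⁻¹) ^ Q = 1 := by rw [inv_pow, hwQ, inv_one]
    have h' : y⁻¹ ^ Q = (-(c * w⁻¹)) ^ Q * w⁻¹ ^ Q.choose 2 := by
      rw [hg _ hwi, inv_pow, h, inv_pow]
      rcases neg_one_pow_eq_or ℂ Q with h1 | h1 <;> rcases hch with h2 | h2 <;>
        simp [h1, h2, inv_neg, inv_I]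
    have := charpoly_shiftV_clock hQ0 hprim.inv hc (inv_ne_zero hy) h'
    rw [inv_inv, inv_inv] at this
    rw [add_right_comm, this]
    have := charpoly_tridiag_eq_hofstadterH' hQ hPQ hc (w := w⁻¹) (Or.inr rfl)
    rwa [inv_inv] at this

lemma det_sub_smul_one_eq_of_charpoly_eq {n : Type*} [Fintype n] [DecidableEq n]
    {M N : Matrix n n ℂ} (h : M.charpoly = N.charpoly) (E : ℂ) :
    (M - E • (1 : Matrix n n ℂ)).det = (N - E • (1 : Matrix n n ℂ)).det := by
  have key : ∀ A : Matrix n n ℂ, (A - E • (1 : Matrix n n ℂ)).det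
      = (-1) ^ Fintype.card n * A.charpoly.eval E := fun A => by
    rw [Matrix.eval_charpoly, ← Matrix.det_neg, neg_sub, Matrix.scalar_apply,
      Matrix.smul_one_eq_diagonal]
  rw [key, key, h]

lemma not_isHermitian_hofstadterH' (P : ℤ) (Q : ℕ) (hQ : 2 ≤ Q) (hPQ : IsCoprime P (Q : ℤ))
    (h4 : 4 ≤ Q) : ¬ (hofstadterH' P Q hQ hPQ).IsHermitian := by
  intro h
  have hs := sin_pi_flux_ne_zero hQ hPQ
  have hprim := qParam_sq_isPrimitiveRoot P Q hQ hPQ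
  rw [hofstadterH'_eq_tridiag] at h
  -- The first pair of opposite entries always agrees, since `J` has superdiagonal entry `1` there.
  -- The second forces `sin² (2 π α) = sin² (π α)`, hence `w ^ 3 = 1`, impossible for a primitive
  -- root of order at least 4.
  have h12 := h.apply (⟨1, by omega⟩ : Fin Q) ⟨2, by omega⟩
  have f1 := four_mul_sin_sq P Q 1
  have f2 := four_mul_sin_sq P Q 2
  simp only [tridiag, Matrix.of_apply, Nat.reduceAdd, if_true, Nat.reduceEqDiff, if_false,
    star_mul', star_neg, star_ofNat, star_def, conj_ofReal] at h12
  rw [Nat.cast_one, one_mul] at f1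
  set w := qParam P Q ^ 2
  have hw0 : w ≠ 0 := hprim.ne_zero (by omega)
  have hw1 : w ≠ 1 := hprim.ne_one (by omega)
  have h21 : (1 - w ^ 2) * (1 - w⁻¹ ^ 2) = (1 - w ^ 1) * (1 - w⁻¹ ^ 1) := by
    rw [f1, f2]
    generalize Real.sin (Real.pi * flux P Q) = s at *
    field_simp at h12
    linear_combination 4 * h12
  refine hprim.pow_ne_one_of_pos_of_lt (l := 3) (by omega) (by omega) ?_
  field_simp at h21
  have h3 : (w - 1) * (w - 1) * (w ^ 3 - 1) = 0 := by
    linear_combination (-(w - 1)) * h21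
  simpa [sub_eq_zero, hw1] using h3

end Hofstadter

end

open Hofstadter in
theorem proposition3 (P : ℤ) (Q : ℕ) (hQ : 2 ≤ Q) (hPQ : IsCoprime P (Q : ℤ)) :
    hofstadterH' P Q hQ hPQ
        = ((-2 * Real.sin (Real.pi * flux P Q) : ℝ) : ℂ) • matJ P Q
      ∧ (∀ nuy : ℝ, nuy = Real.pi / (2 * Q) ∨ nuy = -(Real.pi / (2 * Q)) →
          (hofstadterH P Q (Real.pi / (2 * Q)) nuy).IsHermitian
          ∧ (hofstadterH P Q (Real.pi / (2 * Q)) nuy).charpoly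
              = (hofstadterH' P Q hQ hPQ).charpoly
          ∧ ∀ E : ℂ,
              (hofstadterH P Q (Real.pi / (2 * Q)) nuy
                  - E • (1 : Matrix (Fin Q) (Fin Q) ℂ)).det
                = (hofstadterH' P Q hQ hPQ - E • (1 : Matrix (Fin Q) (Fin Q) ℂ)).det)
      ∧ (4 ≤ Q → ¬ (hofstadterH' P Q hQ hPQ).IsHermitian) :=
  ⟨hofstadterH'_eq_smul_matJ P Q hQ hPQ, fun nuy hn =>
    ⟨hofstadterH_isHermitian P Q _ nuy, charpoly_hofstadterH_midband P Q hQ hPQ nuy hn,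
      det_sub_smul_one_eq_of_charpoly_eq (charpoly_hofstadterH_midband P Q hQ hPQ nuy hn)⟩,
    not_isHermitian_hofstadterH' P Q hQ hPQ⟩
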